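/- Let $\alpha^{\mathtt u}_n,\alpha^{\mathtt d}_n\in[0,1]$ ($1\le n\le\infty$). Let $U=(U_n)_{n\ge0}$ be a Markov chain on left-infinite words over $\{\mathtt u,\mathtt d\}$ (any initial distribution) in which $U_{n+1}$ is obtained from $U_n$ by appending one letter on the right: if $U_n$ ends with a run of exactly $m$ letters $\ell$ ($1\le m\le\infty$), then, given $U_n$, the appended letter differs from $\ell$ with probability $\alpha^{\ell}_m$ and equals $\ell$ with probability $1-\alpha^{\ell}_m$. Let $X_n$ be the rightmost letter of $U_n$, coded by $\mathtt u=1$, $\mathtt d=-1$. Assume that $(\alpha^{\mathtt u}_n)$, $(\alpha^{\mathtt d}_n)$ are such that, for every initial distribution of the chain, almost surely $(X_{n-1},X_n)=(\mathtt u,\mathtt d)$ for infinitely many $n$. Suppose that $\mathbb P((X_0,X_1)=(\mathtt u,\mathtt d))>0$ and work under $\mathbb P(\,\cdot\mid (X_0,X_1)=(\mathtt u,\mathtt d))$. Put $S_0=0$, $S_n=X_1+\dots+X_n$ and $$B_0=\inf\{k\ge0: X_k\ne X_{k+1}\},\qquad B_{n+1}=\inf\{k>B_n: X_k\ne X_{k+1}\},$$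 $$\tau^{\mathtt d}_n=B_{2n-1}-B_{2n-2},\quad \tau^{\mathtt u}_n=B_{2n}-B_{2n-1}\ (n\ge1),\qquad T_n=\sum_{k=1}^n(\tau^{\mathtt d}_k+\tau^{\mathtt u}_k),\quad M_n=S_{T_n}\ (n\ge0).$$ Call $S$ recurrent if for every $x\in\mathbb Z$ almost surely $S_n=x$ for infinitely many $n$, and transient to $\pm\infty$ if almost surely $S_n\to\pm\infty$. Call $M$ oscillating if almost surely $\limsup_n M_n=\infty$ and $\liminf_n M_n=-\infty$, and drifting to $\pm\infty$ if almost surely $M_n\to\pm\infty$. Then: 1. $S$ is recurrent if and only if $M$ is oscillating. 2. $S$ is transient to $\infty$ if and only if $M$ is drifting to $\infty$, and $S$ is transient to $-\infty$ if and only if $M$ is drifting to $-\infty$. 3. Unless there are constants $a,b$ such that almost surely $\tau^{\mathtt d}_n=a$ and $\tau^{\mathtt u}_n=b$ for all $n\ge1$, $S$ is recurrent, transient to $\infty$ or transient to $-\infty$. -/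

import Mathlib

open MeasureTheory ProbabilityTheory Filter

universe v

namespace PersistentWalk

/-- The two-letter alphabet; `true` is the letter `u` (up), `false` the letter `d` (down). -/
abbrev Letter := Bool

/-- The letter for a rise. -/
abbrev up : Letter := true

/-- The letter for a descent. -/
abbrev down : Letter := false

/-- Coding of the letters as jumps: `u` is `+1` and `d` is `-1`. -/
def jump (l : Letter) : ℤ := if l = up then 1 else -1

/-- Left-infinite words `⋯ w 2 w 1 w 0`; `w 0` is the rightmost letter.
They carry the product sigma-algebra. -/
abbrev Word := ℕ → Letter

/-- The word `w l`, that is, `w` with the letter `l` appended on the right. -/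
def append (w : Word) (l : Letter) : Word
  | 0 => l
  | i + 1 => w i

/-- Length (at least 1, possibly infinite) of the run of letters equal to `w 0` at the right end
of `w`. The leaf of the double infinite comb attached to `w` (the prefix of `w`) is `ℓⁿℓ'`, or
`ℓ^∞`, where `ℓ = w 0`, `ℓ'` is the other letter, and `n = runLength w`, so it is encoded by the
pair `(w 0, runLength w)`. -/
noncomputable def runLength (w : Word) : ℕ∞ := ⨅ (i : ℕ) (_ : w i ≠ w 0), (i : ℕ∞)

/-- The distribution on letters attached to the prefix of `w`: after a run of `n` letters `ℓ`
(`1 ≤ n ≤ ∞`) the letter changes with probability `α ℓ n`, and is repeated with probability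
`1 - α ℓ n`. -/
noncomputable def nextProb (α : Letter → ℕ∞ → ℝ) (w : Word) (l : Letter) : ℝ :=
  if l = w 0 then 1 - α (w 0) (runLength w) else α (w 0) (runLength w)

/-- `U` is the variable length Markov chain of the double infinite comb with probabilities of
change `α`: `P(U_{n+1} = U_n ℓ | U_n) = q_{pref(U_n)}(ℓ)`. Summing over the two letters, `U_{n+1}`
is almost surely a one-letter extension of `U_n`, so that `U_n` carries the whole past. The law of
`U 0` is arbitrary. -/
structure IsVLMC (α : Letter → ℕ∞ → ℝ) {Ω : Type v} [MeasurableSpace Ω]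
    (P : Measure Ω) (U : ℕ → Ω → Word) : Prop where
  measurable : ∀ n, Measurable (U n)
  transition : ∀ (n : ℕ) (l : Letter),
    P⟦{ω | U (n + 1) ω = append (U n ω) l} | MeasurableSpace.comap (U n) inferInstance⟧
      =ᵐ[P] fun ω => nextProb α (U n ω) l

/-- The letter process: `X_n` is the rightmost letter of `U_n`. -/
def letters {Ω : Type v} (U : ℕ → Ω → Word) (ω : Ω) (n : ℕ) : Letter := U n ω 0

/-- The renewal assumption: whatever the initial distribution of the chain, almost surely
`(X_n, X_{n+1}) = (u, d)` for infinitely many `n`. -/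
def Admissible (α : Letter → ℕ∞ → ℝ) : Prop :=
  ∀ (Ω : Type v) [MeasurableSpace Ω] (P : Measure Ω) [IsProbabilityMeasure P]
    (U : ℕ → Ω → Word), IsVLMC α P U →
      ∀ᵐ ω ∂P, ∃ᶠ n in atTop, letters U ω n = up ∧ letters U ω (n + 1) = down

/-- The event `(X_0, X_1) = (u, d)`: the initial time is an up-down breaking time. -/
def startEvent {Ω : Type v} (U : ℕ → Ω → Word) : Set Ω :=
  {ω | letters U ω 0 = up ∧ letters U ω 1 = down}

/-! ### Functionals of a path of letters `x 0, x 1, …` -/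

/-- The walk `S_n = X_1 + ⋯ + X_n`. -/
def walk (x : ℕ → Letter) (n : ℕ) : ℤ := ∑ k ∈ Finset.Icc 1 n, jump (x k)

/-- The breaking times `B_0 = inf {k ≥ 0 : X_k ≠ X_{k+1}}` and
`B_{n+1} = inf {k > B_n : X_k ≠ X_{k+1}}`, meaningful on paths with infinitely many changes. -/
noncomputable def breakTime (x : ℕ → Letter) : ℕ → ℕ
  | 0 => sInf {k : ℕ | x k ≠ x (k + 1)}
  | n + 1 => sInf {k : ℕ | breakTime x n < k ∧ x k ≠ x (k + 1)}

/-- Length of the `n`-th descent, `n ≥ 1`. -/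
noncomputable def tauDown (x : ℕ → Letter) (n : ℕ) : ℕ :=
  breakTime x (2 * n - 1) - breakTime x (2 * n - 2)

/-- Length of the `n`-th rise, `n ≥ 1`. -/
noncomputable def tauUp (x : ℕ → Letter) (n : ℕ) : ℕ :=
  breakTime x (2 * n) - breakTime x (2 * n - 1)

/-- The even (up-down) breaking times `T_n`. -/
noncomputable def evenTime (x : ℕ → Letter) (n : ℕ) : ℕ :=
  ∑ k ∈ Finset.Icc 1 n, (tauDown x k + tauUp x k)

/-- The skeleton walk `M_n = S_{T_n}`. -/
noncomputable def skeleton (x : ℕ → Letter) (n : ℕ) : ℤ := walk x (evenTime x n)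

/-! ### Long time behaviour of integer-valued processes -/

section Behaviour

variable {Ω : Type v} [MeasurableSpace Ω]

/-- Every integer is almost surely visited at arbitrarily large times. -/
def Recurrent (P : Measure Ω) (S : Ω → ℕ → ℤ) : Prop :=
  ∀ z : ℤ, ∀ᵐ ω ∂P, ∃ᶠ n in atTop, S ω n = z

/-- Almost sure convergence to `+∞` ("transient to `∞`", "drifting to `∞`"). -/
def TendsToTop (P : Measure Ω) (S : Ω → ℕ → ℤ) : Prop :=
  ∀ᵐ ω ∂P, Tendsto (S ω) atTop atTop

/-- Almost sure convergence to `-∞` ("transient to `-∞`", "drifting to `-∞`"). -/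
def TendsToBot (P : Measure Ω) (S : Ω → ℕ → ℤ) : Prop :=
  ∀ᵐ ω ∂P, Tendsto (S ω) atTop atBot

/-- Almost surely `limsup M_n = ∞` and `liminf M_n = -∞`. -/
def Oscillating (P : Measure Ω) (M : Ω → ℕ → ℤ) : Prop :=
  ∀ᵐ ω ∂P, limsup (fun n => ((M ω n : ℝ) : EReal)) atTop = ⊤ ∧
    liminf (fun n => ((M ω n : ℝ) : EReal)) atTop = ⊥

/-- All descents have one almost surely constant length and all rises have one almost surely
constant length. -/
def ConstantRuns (P : Measure Ω) (X : Ω → ℕ → Letter) : Prop :=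
  ∃ a b : ℕ, ∀ᵐ ω ∂P, ∀ n, 1 ≤ n → tauDown (X ω) n = a ∧ tauUp (X ω) n = b

end Behaviour

end PersistentWalk

open PersistentWalk

/-!
Under the conditional probability the path starts with a descent and, by admissibility, changes
direction infinitely often. Let `R 0, R 1, …` be the lengths of its successive runs, even indices
being descents and odd ones rises. The peaks of the walk are the values `M n` of the skeleton, a sum
of the `R (2 * i + 1) - R (2 * i)`, and its valleys are the values `M n - R (2 * n)`; in between the
walk is monotone (`StartPath.walk_bounds`).

*The runs are independent.* The words `U n` record the past of the chain, so the transition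
probabilities given `U n` are also transition probabilities given `X 0, …, X n`
(`IsVLMC.measure_inter_next`). After the initial change `ud` every run starts and ends in view, so
that its law depends only on its letter; multiplying the transition probabilities gives a product
formula for the lengths of the first `n` runs (`IsVLMC.cond_runLen_eq`). Hence the `R i` are
independent, with a law that depends only on the parity of `i`.

*Comparison of the walk with its skeleton.* All implications but two are statements about single
paths. Those two, namely that a drift of `M` to `∞` forces one of the walk, and that a recurrent
walk makes `M` unbounded below, need that low valleys produce low peaks. The rise out of a valley is
independent of the past and takes some value `K` with positive probability, so by Lévy's conditional
Borel-Cantelli lemma infinitely many valleys below `C` entail infinitely many peaks below `C + K`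
(`ae_frequently_peak_le`). No moment of the run lengths is needed.

*Trichotomy.* If the steps of `M` are almost surely zero, then independent descents and rises agree,
so they are constant (`exists_ae_eq_const_of_indepFun`). Otherwise the upper limit of `M` is
almost surely not an integer, since after each visit the walk leaves it with a fixed positive
probability (`ae_tendsto_atBot_of_not_frequently`), and the same holds for the lower limit. By
Kolmogorov's zero-one law each of them is a constant, `∞` or `-∞` (`blockSum_trichotomy`).
-/

/-! ### Shape of the paths -/

namespace PersistentWalk

/-- Paths that start with a descent and change direction infinitely often; on these none of the
infima in `breakTime` is a junk value. -/
structure StartPath (x : ℕ → Letter) : Prop where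
  zero : x 0 = up
  one : x 1 = down
  frequently_change : ∃ᶠ k in atTop, x k ≠ x (k + 1)

/-- Length of the `n`-th run (counted from `0`) after time `breakTime x 0`. Even indices are
descents and odd ones are rises when `StartPath x` holds. -/
noncomputable def runLen (x : ℕ → Letter) (n : ℕ) : ℕ := breakTime x (n + 1) - breakTime x n

lemma tauDown_succ (x : ℕ → Letter) (n : ℕ) : tauDown x (n + 1) = runLen x (2 * n) := by
  simp only [tauDown, runLen]
  congr 2

lemma tauUp_succ (x : ℕ → Letter) (n : ℕ) : tauUp x (n + 1) = runLen x (2 * n + 1) := by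
  simp only [tauUp, runLen]
  congr 2

namespace StartPath

variable {x : ℕ → Letter}

lemma breakTime_zero (hx : StartPath x) : breakTime x 0 = 0 := by
  have : x 0 ≠ x (0 + 1) := by simp [hx.zero, hx.one]
  exact Nat.le_zero.1 (Nat.sInf_le this)

lemma breakTime_succ_mem (hx : StartPath x) (n : ℕ) :
    breakTime x (n + 1) ∈ {k : ℕ | breakTime x n < k ∧ x k ≠ x (k + 1)} := by
  obtain ⟨k, hk, hne⟩ := frequently_atTop.1 hx.frequently_change (breakTime x n + 1)
  exact Nat.sInf_mem ⟨k, hk, hne⟩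

lemma breakTime_lt_succ (hx : StartPath x) (n : ℕ) : breakTime x n < breakTime x (n + 1) :=
  (hx.breakTime_succ_mem n).1

lemma change_breakTime (hx : StartPath x) (n : ℕ) :
    x (breakTime x n) ≠ x (breakTime x n + 1) := by
  cases n with
  | zero => simp [hx.breakTime_zero, hx.zero, hx.one]
  | succ n => exact (hx.breakTime_succ_mem n).2

lemma eq_succ_of_lt_of_lt {n k : ℕ} (h₁ : breakTime x n < k) (h₂ : k < breakTime x (n + 1)) :
    x k = x (k + 1) := by
  by_contra h
  exact Nat.notMem_of_lt_sInf h₂ ⟨h₁, h⟩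

lemma strictMono_breakTime (hx : StartPath x) : StrictMono (breakTime x) :=
  strictMono_nat_of_lt_succ hx.breakTime_lt_succ

lemma breakTime_succ (hx : StartPath x) (n : ℕ) :
    breakTime x (n + 1) = breakTime x n + runLen x n := by
  have := hx.breakTime_lt_succ n
  simp only [runLen]; omega

lemma runLen_pos (hx : StartPath x) (n : ℕ) : 0 < runLen x n := by
  have := hx.breakTime_lt_succ n
  simp only [runLen]; omega

/-- The letters of the `n`-th run all equal `n.bodd`, i.e. `down` for even `n`, `up` for odd `n`. -/
lemma eq_bodd (hx : StartPath x) (n : ℕ) {k : ℕ} (h₁ : breakTime x n < k)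
    (h₂ : k ≤ breakTime x (n + 1)) : x k = n.bodd := by
  induction n generalizing k with
  | zero =>
    rw [hx.breakTime_zero] at h₁
    induction k, h₁ using Nat.le_induction with
    | base => simp [hx.one]
    | succ k hk ih =>
      rw [← eq_succ_of_lt_of_lt (x := x) (n := 0) (k := k) (by rw [hx.breakTime_zero]; omega)
        (by omega)]
      exact ih (by omega)
  | succ n ihn =>
    induction k, h₁ using Nat.le_induction with
    | base =>
      have h := hx.change_breakTime (n + 1)
      rw [ihn (hx.breakTime_lt_succ n) le_rfl] at h
      simp only [Nat.succ_eq_add_one, Nat.bodd_succ]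
      revert h
      cases x (breakTime x (n + 1) + 1) <;> cases n.bodd <;> simp
    | succ k hk ih =>
      rw [← eq_succ_of_lt_of_lt (x := x) (n := n + 1) (k := k) (by omega) (by omega)]
      exact ih (by omega)

lemma walk_of_mem_run (hx : StartPath x) (n j : ℕ) (hj : j ≤ runLen x n) :
    walk x (breakTime x n + j) = walk x (breakTime x n) + j * jump n.bodd := by
  induction j with
  | zero => simp
  | succ j ih =>
    have h := hx.breakTime_succ n
    rw [← add_assoc, walk, Finset.sum_Icc_succ_top (by omega), ← walk, ih (by omega),
      hx.eq_bodd n (by omega) (by omega)]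
    push_cast; ring

lemma evenTime_eq (hx : StartPath x) (n : ℕ) : evenTime x n = breakTime x (2 * n) := by
  induction n with
  | zero => simp [evenTime, hx.breakTime_zero]
  | succ n ih =>
    rw [evenTime, Finset.sum_Icc_succ_top (by omega), ← evenTime, ih, tauDown_succ, tauUp_succ,
      mul_add_one, ← add_assoc, ← hx.breakTime_succ, ← hx.breakTime_succ]

lemma skeleton_eq (hx : StartPath x) (n : ℕ) : skeleton x n = walk x (breakTime x (2 * n)) := by
  rw [skeleton, hx.evenTime_eq]

lemma walk_descent (hx : StartPath x) (n j : ℕ) (hj : j ≤ runLen x (2 * n)) :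
    walk x (breakTime x (2 * n) + j) = skeleton x n - j := by
  rw [hx.walk_of_mem_run _ _ hj, hx.skeleton_eq]
  simp [jump, sub_eq_add_neg]

lemma walk_breakTime_odd (hx : StartPath x) (n : ℕ) :
    walk x (breakTime x (2 * n + 1)) = skeleton x n - runLen x (2 * n) := by
  rw [hx.breakTime_succ, hx.walk_descent n _ le_rfl]

lemma walk_rise (hx : StartPath x) (n j : ℕ) (hj : j ≤ runLen x (2 * n + 1)) :
    walk x (breakTime x (2 * n + 1) + j) = skeleton x n - runLen x (2 * n) + j := by
  rw [hx.walk_of_mem_run _ _ hj, hx.walk_breakTime_odd]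
  simp [jump]

lemma skeleton_succ (hx : StartPath x) (n : ℕ) :
    skeleton x (n + 1) = skeleton x n + ((runLen x (2 * n + 1) : ℤ) - runLen x (2 * n)) := by
  rw [hx.skeleton_eq (n + 1), mul_add_one, hx.breakTime_succ, hx.walk_rise n _ le_rfl]
  ring

lemma skeleton_eq_sum (hx : StartPath x) (n : ℕ) :
    skeleton x n = ∑ i ∈ Finset.range n, ((runLen x (2 * i + 1) : ℤ) - runLen x (2 * i)) := by
  induction n with
  | zero => simp [hx.skeleton_eq, hx.breakTime_zero, walk]
  | succ n ih => rw [hx.skeleton_succ, ih, Finset.sum_range_succ]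

lemma exists_mem_cycle (hx : StartPath x) {N k : ℕ} (hk : breakTime x (2 * N) ≤ k) :
    ∃ n, N ≤ n ∧ breakTime x (2 * n) ≤ k ∧ k < breakTime x (2 * (n + 1)) := by
  have hmono : StrictMono fun n => breakTime x (2 * n) :=
    hx.strictMono_breakTime.comp (strictMono_mul_left_of_pos two_pos)
  induction k, hk using Nat.le_induction with
  | base => exact ⟨N, le_rfl, le_rfl, hmono (Nat.lt_succ_self N)⟩
  | succ k hk ih =>
    obtain ⟨n, hn, h₁, h₂⟩ := ih
    rcases (Nat.succ_le_of_lt h₂).lt_or_eq with h | h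
    · exact ⟨n, hn, by omega, h⟩
    · exact ⟨n + 1, by omega, h.symm.le, by
        have : breakTime x (2 * (n + 1)) < breakTime x (2 * (n + 1 + 1)) :=
          hmono (Nat.lt_succ_self (n + 1))
        omega⟩

/-- Within one descent and the following rise, the walk lies between the valley
`skeleton x n - runLen x (2 * n)` and the higher one of the two neighbouring peaks. -/
lemma walk_bounds (hx : StartPath x) {n k : ℕ} (h₁ : breakTime x (2 * n) ≤ k)
    (h₂ : k < breakTime x (2 * (n + 1))) :
    skeleton x n - runLen x (2 * n) ≤ walk x k ∧
      walk x k ≤ max (skeleton x n) (skeleton x (n + 1)) := by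
  have e₁ := hx.breakTime_succ (2 * n)
  have e₂ : breakTime x (2 * n + 2) = _ := hx.breakTime_succ (2 * n + 1)
  rw [mul_add_one] at h₂
  rcases le_total k (breakTime x (2 * n + 1)) with h | h
  · obtain ⟨j, rfl⟩ := Nat.exists_eq_add_of_le h₁
    rw [hx.walk_descent n j (by omega)]
    exact ⟨by omega, le_max_of_le_left (by omega)⟩
  · obtain ⟨j, rfl⟩ := Nat.exists_eq_add_of_le h
    rw [hx.walk_rise n j (by omega), hx.skeleton_succ]
    exact ⟨by omega, le_max_of_le_right (by omega)⟩

lemma tendsto_breakTime_even (hx : StartPath x) :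
    Tendsto (fun n => breakTime x (2 * n)) atTop atTop :=
  (hx.strictMono_breakTime.comp (strictMono_mul_left_of_pos two_pos)).tendsto_atTop

lemma tendsto_skeleton (hx : StartPath x) {l : Filter ℤ} (h : Tendsto (walk x) atTop l) :
    Tendsto (skeleton x) atTop l := by
  have : skeleton x = walk x ∘ fun n => breakTime x (2 * n) := funext hx.skeleton_eq
  rw [this]
  exact h.comp hx.tendsto_breakTime_even

lemma tendsto_walk_atBot (hx : StartPath x) (h : Tendsto (skeleton x) atTop atBot) :
    Tendsto (walk x) atTop atBot := by
  refine tendsto_atBot.2 fun C => ?_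
  obtain ⟨N, hN⟩ := eventually_atTop.1 (tendsto_atBot.1 h C)
  filter_upwards [eventually_ge_atTop (breakTime x (2 * N))] with k hk
  obtain ⟨n, hn, h₁, h₂⟩ := hx.exists_mem_cycle hk
  exact (hx.walk_bounds h₁ h₂).2.trans (max_le (hN n hn) (hN (n + 1) (by omega)))

lemma tendsto_walk_atTop (hx : StartPath x)
    (h : Tendsto (fun n => skeleton x n - runLen x (2 * n)) atTop atTop) :
    Tendsto (walk x) atTop atTop := by
  refine tendsto_atTop.2 fun C => ?_
  obtain ⟨N, hN⟩ := eventually_atTop.1 (tendsto_atTop.1 h C)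
  filter_upwards [eventually_ge_atTop (breakTime x (2 * N))] with k hk
  obtain ⟨n, hn, h₁, h₂⟩ := hx.exists_mem_cycle hk
  exact (hN n hn).trans (hx.walk_bounds h₁ h₂).1

lemma frequently_le_skeleton (hx : StartPath x) (C : ℤ) (h : ∃ᶠ k in atTop, walk x k = C) :
    ∃ᶠ n in atTop, C ≤ skeleton x n := by
  refine frequently_atTop.2 fun N => ?_
  obtain ⟨k, hk, e⟩ := frequently_atTop.1 h (breakTime x (2 * N))
  obtain ⟨n, hn, h₁, h₂⟩ := hx.exists_mem_cycle hk
  rcases le_max_iff.1 (e ▸ (hx.walk_bounds h₁ h₂).2) with h | h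
  · exact ⟨n, hn, h⟩
  · exact ⟨n + 1, by omega, h⟩

lemma frequently_valley_le (hx : StartPath x) (C : ℤ) (h : ∃ᶠ k in atTop, walk x k = C) :
    ∃ᶠ n in atTop, skeleton x n - runLen x (2 * n) ≤ C := by
  refine frequently_atTop.2 fun N => ?_
  obtain ⟨k, hk, e⟩ := frequently_atTop.1 h (breakTime x (2 * N))
  obtain ⟨n, hn, h₁, h₂⟩ := hx.exists_mem_cycle hk
  exact ⟨n, hn, e ▸ (hx.walk_bounds h₁ h₂).1⟩

end StartPath

lemma walk_succ (x : ℕ → Letter) (n : ℕ) : walk x (n + 1) = walk x n + jump (x (n + 1)) := by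
  rw [walk, Finset.sum_Icc_succ_top (by omega), ← walk]

/-- Discrete intermediate value theorem for the walk. -/
lemma exists_walk_eq (x : ℕ → Letter) {z : ℤ} {m n : ℕ} (hmn : m ≤ n) (hm : walk x m ≤ z)
    (hn : z ≤ walk x n) : ∃ k, m ≤ k ∧ walk x k = z := by
  induction n, hmn using Nat.le_induction with
  | base => exact ⟨m, le_rfl, le_antisymm hm hn⟩
  | succ n hmn ih =>
    by_cases h : z ≤ walk x n
    · exact ih h
    · refine ⟨n + 1, by omega, ?_⟩
      rw [walk_succ] at hn ⊢
      have : jump (x (n + 1)) ≤ 1 := by unfold jump; split_ifs <;> simp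
      omega

lemma StartPath.frequently_walk_eq {x : ℕ → Letter} (hx : StartPath x)
    (htop : ∀ C, ∃ᶠ n in atTop, C ≤ skeleton x n) (hbot : ∀ C, ∃ᶠ n in atTop, skeleton x n ≤ C)
    (z : ℤ) : ∃ᶠ k in atTop, walk x k = z := by
  refine frequently_atTop.2 fun N => ?_
  have hmono : StrictMono fun n => breakTime x (2 * n) :=
    hx.strictMono_breakTime.comp (strictMono_mul_left_of_pos two_pos)
  obtain ⟨m, hm, hmz⟩ := frequently_atTop.1 (hbot z) N
  obtain ⟨n, hn, hnz⟩ := frequently_atTop.1 (htop z) m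
  rw [hx.skeleton_eq] at hmz hnz
  obtain ⟨k, hk, e⟩ := exists_walk_eq x (hmono.monotone hn) hmz hnz
  exact ⟨k, (hm.trans (hmono.id_le m)).trans hk, e⟩

lemma limsup_eq_top_iff (f : ℕ → ℤ) :
    limsup (fun n => ((f n : ℝ) : EReal)) atTop = ⊤ ↔ ∀ C, ∃ᶠ n in atTop, C ≤ f n := by
  constructor
  · intro h C
    have : ((C : ℝ) : EReal) < limsup (fun n => ((f n : ℝ) : EReal)) atTop := by
      rw [h]; exact EReal.coe_lt_top _
    refine (frequently_lt_of_lt_limsup (by isBoundedDefault) this).mono fun n hn => ?_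
    exact_mod_cast (EReal.coe_lt_coe_iff.1 hn).le
  · intro h
    refine EReal.eq_top_iff_forall_lt _ |>.2 fun y => ?_
    obtain ⟨C, hC⟩ := exists_int_gt y
    refine lt_of_lt_of_le (EReal.coe_lt_coe_iff.2 hC)
      (le_limsup_of_frequently_le ((h C).mono fun n hn => ?_) (by isBoundedDefault))
    exact EReal.coe_le_coe_iff.2 (by exact_mod_cast hn)

lemma liminf_eq_bot_iff (f : ℕ → ℤ) :
    liminf (fun n => ((f n : ℝ) : EReal)) atTop = ⊥ ↔ ∀ C, ∃ᶠ n in atTop, f n ≤ C := by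
  constructor
  · intro h C
    have : liminf (fun n => ((f n : ℝ) : EReal)) atTop < ((C : ℝ) : EReal) := by
      rw [h]; exact EReal.bot_lt_coe _
    refine (frequently_lt_of_liminf_lt (by isBoundedDefault) this).mono fun n hn => ?_
    exact_mod_cast (EReal.coe_lt_coe_iff.1 hn).le
  · intro h
    refine EReal.eq_bot_iff_forall_lt _ |>.2 fun y => ?_
    obtain ⟨C, hC⟩ := exists_int_lt y
    refine lt_of_le_of_lt
      (liminf_le_of_frequently_le ((h C).mono fun n hn => ?_) (by isBoundedDefault))
      (EReal.coe_lt_coe_iff.2 hC)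
    exact EReal.coe_le_coe_iff.2 (by exact_mod_cast hn)

end PersistentWalk

/-! ### Random walks whose steps are made of two independent variables -/

namespace PersistentWalk

section RandomWalk

variable {Ω : Type v} {mΩ : MeasurableSpace Ω} {Q : Measure Ω}

/-- A consequence of Lévy's conditional Borel-Cantelli lemma: if `A n` is known at time `n` and
`B n`, independent of the past up to time `n`, has probability at least `p > 0`, then almost surely
`A n ∩ B n` occurs infinitely often as soon as `A n` does. -/
lemma ae_frequently_and_of_indep [IsProbabilityMeasure Q] (ℱ : Filtration ℕ mΩ)
    (ℬ : ℕ → MeasurableSpace Ω) {A B : ℕ → Set Ω} (hA : ∀ n, MeasurableSet[ℱ n] (A n))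
    (hℬ : ∀ n, ℬ n ≤ ℱ (n + 1)) (hB : ∀ n, MeasurableSet[ℬ n] (B n))
    (hind : ∀ n, Indep (ℬ n) (ℱ n) Q) {p : ℝ} (hp : 0 < p) (hpB : ∀ n, p ≤ Q.real (B n)) :
    ∀ᵐ ω ∂Q, (∃ᶠ n in atTop, ω ∈ A n) → ∃ᶠ n in atTop, ω ∈ A n ∧ ω ∈ B n := by
  let s : ℕ → Set Ω := fun n => Nat.casesOn n ∅ fun k => A k ∩ B k
  have hs : ∀ n, MeasurableSet[ℱ n] (s n) := by
    rintro (_ | n)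
    · exact @MeasurableSet.empty _ (ℱ 0)
    · exact MeasurableSet.inter (ℱ.mono (Nat.le_succ n) _ (hA n)) (hℬ n _ (hB n))
  have hcond : ∀ n, Q[(s (n + 1)).indicator (1 : Ω → ℝ) | ℱ n] =ᵐ[Q]
      (A n).indicator fun _ => Q.real (B n) := by
    intro n
    have hBm : MeasurableSet (B n) := ((hℬ n).trans (ℱ.le _)) _ (hB n)
    have e : (s (n + 1)).indicator (1 : Ω → ℝ) = (A n).indicator ((B n).indicator 1) :=
      (Set.indicator_indicator (A n) (B n) 1).symm
    rw [e]
    refine (condExp_indicator ((integrable_const (1 : ℝ)).indicator hBm) (hA n)).trans ?_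
    have h := condExp_indep_eq ((hℬ n).trans (ℱ.le _)) (ℱ.le n)
      (f := (B n).indicator (1 : Ω → ℝ)) (μ := Q)
      ((stronglyMeasurable_one).indicator (hB n)) (hind n)
    filter_upwards [h] with ω hω
    by_cases hmem : ω ∈ A n
    · rw [Set.indicator_of_mem hmem, Set.indicator_of_mem hmem]
      exact hω.trans (integral_indicator_one hBm)
    · rw [Set.indicator_of_notMem hmem, Set.indicator_of_notMem hmem]
  filter_upwards [ae_mem_limsup_atTop_iff Q hs, ae_all_iff.2 hcond] with ω h₁ h₂ hfreq
  have hlim : ω ∈ limsup s atTop := by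
    rw [h₁]
    have hA' : ω ∈ limsup A atTop := by rwa [mem_limsup_iff_frequently_mem]
    rw [Set.limsup_eq_tendsto_sum_indicator_atTop hp] at hA'
    refine tendsto_atTop_mono (fun n => Finset.sum_le_sum fun k _ => ?_) hA'
    rw [h₂ k]
    exact Set.indicator_le_indicator (hpB k)
  rw [mem_limsup_iff_frequently_mem, frequently_atTop] at hlim
  refine frequently_atTop.2 fun N => ?_
  obtain ⟨n, hn, hmem⟩ := hlim (N + 1)
  obtain ⟨n, rfl⟩ : ∃ k, n = k + 1 := ⟨n - 1, by omega⟩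
  exact ⟨n, by omega, hmem⟩

/-- The sigma-algebra generated by the variables `R j`, `j ∈ s`. -/
@[reducible]
def sigmaOf (R : ℕ → Ω → ℕ) (s : Set ℕ) : MeasurableSpace Ω :=
  ⨆ j ∈ s, MeasurableSpace.comap (R j) inferInstance

variable {R : ℕ → Ω → ℕ}

lemma sigmaOf_le (hR : ∀ j, Measurable (R j)) (s : Set ℕ) : sigmaOf R s ≤ mΩ :=
  iSup₂_le fun j _ => (hR j).comap_le

lemma sigmaOf_mono {s t : Set ℕ} (h : s ⊆ t) : sigmaOf R s ≤ sigmaOf R t :=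
  biSup_mono h

lemma measurable_sigmaOf {s : Set ℕ} {j : ℕ} (hj : j ∈ s) : Measurable[sigmaOf R s] (R j) :=
  measurable_iff_comap_le.2 (le_biSup (fun j => MeasurableSpace.comap (R j) inferInstance) hj)

lemma indep_sigmaOf (hR : ∀ j, Measurable (R j)) (hind : iIndepFun R Q) {s t : Set ℕ}
    (hst : Disjoint s t) : Indep (sigmaOf R s) (sigmaOf R t) Q :=
  indep_iSup_of_disjoint (fun j => (hR j).comap_le) hind.iIndep hst

/-- The filtration whose `n`-th sigma-algebra is generated by the first `2 * n + c` runs. -/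
def runFiltration (hR : ∀ j, Measurable (R j)) (c : ℕ) : Filtration ℕ mΩ where
  seq n := sigmaOf R (Set.Iio (2 * n + c))
  mono' _ _ h := sigmaOf_mono (Set.Iio_subset_Iio (by omega))
  le' _ := sigmaOf_le hR _

lemma ae_frequently_and [IsProbabilityMeasure Q] (hR : ∀ j, Measurable (R j))
    (hind : iIndepFun R Q) (c : ℕ) {A B : ℕ → Set Ω}
    (hA : ∀ n, MeasurableSet[sigmaOf R (Set.Iio (2 * n + c))] (A n))
    (hB : ∀ n, MeasurableSet[sigmaOf R (Set.Ico (2 * n + c) (2 * (n + 1) + c))] (B n))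
    {p : ℝ} (hp : 0 < p) (hpB : ∀ n, p ≤ Q.real (B n)) :
    ∀ᵐ ω ∂Q, (∃ᶠ n in atTop, ω ∈ A n) → ∃ᶠ n in atTop, ω ∈ A n ∧ ω ∈ B n := by
  refine ae_frequently_and_of_indep (runFiltration hR c)
    (fun n => sigmaOf R (Set.Ico (2 * n + c) (2 * (n + 1) + c))) hA (fun n => ?_) hB (fun n => ?_)
    hp hpB
  · exact sigmaOf_mono fun j hj => hj.2
  · refine indep_sigmaOf hR hind (Set.disjoint_left.2 fun j h₁ h₂ => ?_)
    exact absurd h₁.1 (not_le.2 h₂)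

/-- The random walk whose `i`-th step is `g (R (2 * i)) (R (2 * i + 1))`, observed between the
times `m` and `n`. -/
def blockSum (R : ℕ → Ω → ℕ) (g : ℕ → ℕ → ℤ) (m n : ℕ) (ω : Ω) : ℤ :=
  ∑ i ∈ Finset.Ico m n, g (R (2 * i) ω) (R (2 * i + 1) ω)

variable {g : ℕ → ℕ → ℤ}

lemma blockSum_zero_succ (n : ℕ) (ω : Ω) :
    blockSum R g 0 (n + 1) ω = blockSum R g 0 n ω + g (R (2 * n) ω) (R (2 * n + 1) ω) := by
  rw [blockSum, Finset.sum_Ico_succ_top (by omega), ← blockSum]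

lemma measurable_step {s : Set ℕ} {i j : ℕ} (hi : i ∈ s) (hj : j ∈ s) :
    Measurable[sigmaOf R s] fun ω => g (R i ω) (R j ω) := by
  have h : Measurable[sigmaOf R s] fun ω => (R i ω, R j ω) :=
    (measurable_sigmaOf hi).prodMk (measurable_sigmaOf hj)
  exact (Measurable.of_discrete (f := fun q : ℕ × ℕ => g q.1 q.2)).comp h

lemma measurable_blockSum {s : Set ℕ} (m n : ℕ) (hs : Set.Ico (2 * m) (2 * n) ⊆ s) :
    Measurable[sigmaOf R s] (blockSum R g m n) := by
  refine Finset.measurable_sum (m := sigmaOf R s) _ fun i hi => ?_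
  rw [Finset.mem_Ico] at hi
  exact measurable_step (hs ⟨by omega, by omega⟩) (hs ⟨by omega, by omega⟩)

/-- All steps of the walk have the same law. -/
lemma measure_step_eq [IsProbabilityMeasure Q] (hR : ∀ j, Measurable (R j)) (hind : iIndepFun R Q)
    (heven : ∀ n, Q.map (R (2 * n)) = Q.map (R 0))
    (hodd : ∀ n, Q.map (R (2 * n + 1)) = Q.map (R 1)) (T : Set (ℕ × ℕ)) (n : ℕ) :
    Q {ω | (R (2 * n) ω, R (2 * n + 1) ω) ∈ T} = Q {ω | (R 0 ω, R 1 ω) ∈ T} := by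
  have key : ∀ i j, i ≠ j → Q {ω | (R i ω, R j ω) ∈ T} = ((Q.map (R i)).prod (Q.map (R j))) T := by
    intro i j hij
    rw [← (indepFun_iff_map_prod_eq_prod_map_map (hR i).aemeasurable (hR j).aemeasurable).1
      (hind.indepFun hij), Measure.map_apply ((hR i).prodMk (hR j)) T.to_countable.measurableSet]
    rfl
  rw [key _ _ (by omega), key _ _ zero_ne_one, heven, hodd]

/-- A nondegenerate random walk which does not exceed every level infinitely often tends to `-∞`:
its upper limit cannot be an integer, since each visit of it would be followed with a fixed positive
probability by a larger value, or, for nonincreasing walks, by a definitive departure. -/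
lemma ae_tendsto_atBot_of_not_frequently [IsProbabilityMeasure Q] (hR : ∀ j, Measurable (R j))
    (hind : iIndepFun R Q) (heven : ∀ n, Q.map (R (2 * n)) = Q.map (R 0))
    (hodd : ∀ n, Q.map (R (2 * n + 1)) = Q.map (R 1))
    (hne : ¬ ∀ᵐ ω ∂Q, g (R 0 ω) (R 1 ω) = 0) :
    ∀ᵐ ω ∂Q, (¬ ∀ C, ∃ᶠ n in atTop, C ≤ blockSum R g 0 n ω) →
      Tendsto (fun n => blockSum R g 0 n ω) atTop atBot := by
  -- a visit of `L` is infinitely often followed by a step in `T`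
  have hstep : ∀ T : Set ℤ, Q {ω | g (R 0 ω) (R 1 ω) ∈ T} ≠ 0 → ∀ᵐ ω ∂Q, ∀ L : ℤ,
      (∃ᶠ n in atTop, blockSum R g 0 n ω = L) → ∃ᶠ n in atTop, blockSum R g 0 n ω = L ∧
        g (R (2 * n) ω) (R (2 * n + 1) ω) ∈ T := by
    intro T hT
    refine ae_all_iff.2 fun L => ?_
    refine ae_frequently_and (A := fun n => {ω | blockSum R g 0 n ω = L})
      (B := fun n => {ω | g (R (2 * n) ω) (R (2 * n + 1) ω) ∈ T}) hR hind 0 (fun n => ?_)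
      (fun n => ?_) (p := Q.real {ω | g (R 0 ω) (R 1 ω) ∈ T})
      (ENNReal.toReal_pos hT (measure_ne_top _ _)) fun n => ?_
    · exact measurable_blockSum (s := Set.Iio (2 * n + 0)) 0 n (fun j hj => hj.2)
        (measurableSet_singleton L)
    · exact measurable_step (s := Set.Ico (2 * n + 0) (2 * (n + 1) + 0)) (i := 2 * n)
        (j := 2 * n + 1) ⟨by omega, by omega⟩ ⟨by omega, by omega⟩ T.to_countable.measurableSet
    · exact (congrArg ENNReal.toReal
        (measure_step_eq hR hind heven hodd {q | g q.1 q.2 ∈ T} n)).ge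
  -- an upper limit which is neither `∞` nor `-∞` is an integer
  have hlim : ∀ ω, (¬ ∀ C, ∃ᶠ n in atTop, C ≤ blockSum R g 0 n ω) →
      ¬ Tendsto (fun n => blockSum R g 0 n ω) atTop atBot →
      ∃ L, (∃ᶠ n in atTop, blockSum R g 0 n ω = L) ∧ ∀ᶠ n in atTop, blockSum R g 0 n ω ≤ L := by
    intro ω h₁ h₂
    push Not at h₁
    obtain ⟨C, hC⟩ := h₁
    rw [tendsto_atBot] at h₂
    push Not at h₂
    obtain ⟨D, hD⟩ := h₂
    obtain ⟨L, hL, hmax⟩ := Int.exists_greatest_of_bdd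
      (P := fun L => ∃ᶠ n in atTop, L ≤ blockSum R g 0 n ω)
      ⟨C, fun z hz => by
        obtain ⟨n, h₁, h₂⟩ := (hz.and_eventually hC).exists
        omega⟩
      ⟨D, hD.mono fun n hn => hn.le⟩
    have hev : ∀ᶠ n in atTop, blockSum R g 0 n ω ≤ L := by
      by_contra h
      have := hmax (L + 1) ((not_eventually.1 h).mono fun n hn => by omega)
      omega
    exact ⟨L, (hL.and_eventually hev).mono fun n hn => le_antisymm hn.2 hn.1, hev⟩
  by_cases hpos : Q {ω | g (R 0 ω) (R 1 ω) ∈ Set.Ici 1} = 0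
  · have hneg : Q {ω | g (R 0 ω) (R 1 ω) ∈ Set.Iic (-1)} ≠ 0 := by
      intro h0
      refine hne ?_
      filter_upwards [measure_eq_zero_iff_ae_notMem.1 hpos, measure_eq_zero_iff_ae_notMem.1 h0]
        with ω h₁ h₂
      simp only [Set.mem_Ici, Set.mem_Iic] at h₁ h₂
      omega
    have hmono : ∀ᵐ ω ∂Q, ∀ n, g (R (2 * n) ω) (R (2 * n + 1) ω) ≤ 0 := by
      refine ae_all_iff.2 fun n => ?_
      have h := (measure_step_eq hR hind heven hodd {q | g q.1 q.2 ∈ Set.Ici 1} n).trans hpos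
      filter_upwards [measure_eq_zero_iff_ae_notMem.1 h] with ω h
      simp only [Set.mem_Ici] at h
      omega
    filter_upwards [hstep _ hneg, hmono] with ω hω hle hub
    by_contra hbot
    obtain ⟨L, hL, -⟩ := hlim ω hub hbot
    have hanti : Antitone fun n => blockSum R g 0 n ω := antitone_nat_of_succ_le fun n => by
      have := hle n
      rw [blockSum_zero_succ]; omega
    obtain ⟨n, hn, hs⟩ := (hω L hL).exists
    obtain ⟨k, hk, hkL⟩ := frequently_atTop.1 hL (n + 1)
    have h₁ : blockSum R g 0 k ω ≤ blockSum R g 0 (n + 1) ω := hanti hk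
    rw [blockSum_zero_succ] at h₁
    rw [Set.mem_Iic] at hs
    omega
  · filter_upwards [hstep _ hpos] with ω hω hub
    by_contra hbot
    obtain ⟨L, hL, hev⟩ := hlim ω hub hbot
    obtain ⟨n, ⟨hn, hs⟩, hlt⟩ :=
      ((hω L hL).and_eventually ((tendsto_add_atTop_nat 1).eventually hev)).exists
    rw [blockSum_zero_succ] at hlt
    rw [Set.mem_Ici] at hs
    omega

/-- Kolmogorov's zero-one law for the event that the walk exceeds every level infinitely often. -/
lemma ae_frequently_le_or_ae_not [IsProbabilityMeasure Q] (hR : ∀ j, Measurable (R j))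
    (hind : iIndepFun R Q) (g : ℕ → ℕ → ℤ) :
    (∀ᵐ ω ∂Q, ∀ C, ∃ᶠ n in atTop, C ≤ blockSum R g 0 n ω) ∨
      ∀ᵐ ω ∂Q, ¬ ∀ C, ∃ᶠ n in atTop, C ≤ blockSum R g 0 n ω := by
  let E : Set Ω := {ω | ∀ C, ∃ᶠ n in atTop, C ≤ blockSum R g 0 n ω}
  -- the first `m` steps do not matter
  have hE : ∀ m, E = ⋂ C : ℤ, ⋂ N : ℕ, ⋃ n ≥ N, {ω | C ≤ blockSum R g m n ω} := by
    intro m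
    have hsplit : ∀ ω n, m ≤ n →
        blockSum R g 0 n ω = blockSum R g 0 m ω + blockSum R g m n ω := fun ω n hn =>
      (Finset.sum_Ico_consecutive _ (Nat.zero_le m) hn).symm
    ext ω
    simp only [E, Set.mem_ofPred_eq, frequently_atTop, Set.mem_iInter, Set.mem_iUnion,
      exists_prop]
    constructor
    · intro h C N
      obtain ⟨n, hn, hC⟩ := h (C + blockSum R g 0 m ω) (max N m)
      rw [hsplit ω n (le_of_max_le_right hn)] at hC
      exact ⟨n, le_of_max_le_left hn, by omega⟩
    · intro h C N
      obtain ⟨n, hn, hC⟩ := h (C - blockSum R g 0 m ω) (max N m)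
      have := hsplit ω n (le_of_max_le_right hn)
      exact ⟨n, le_of_max_le_left hn, by omega⟩
  have htail : MeasurableSet[limsup (fun j => MeasurableSpace.comap (R j) inferInstance) atTop]
      E := by
    rw [limsup_eq_iInf_iSup_of_nat, MeasurableSpace.measurableSet_iInf]
    intro m
    have : MeasurableSet[sigmaOf R (Set.Ici m)] E := by
      rw [hE m]
      refine MeasurableSet.iInter fun C => MeasurableSet.iInter fun N => MeasurableSet.iUnion
        fun n => MeasurableSet.iUnion fun _ => ?_
      exact measurable_blockSum (s := Set.Ici m) m n
        (fun j hj => by have := hj.1; simp only [Set.mem_Ici]; omega) measurableSet_Ici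
    exact this
  rcases measure_zero_or_one_of_measurableSet_limsup_atTop (fun j => (hR j).comap_le) hind.iIndep
    htail with h | h
  · exact Or.inr (measure_eq_zero_iff_ae_notMem.1 h)
  · left
    have hEm : MeasurableSet E := by
      have hle : limsup (fun j => MeasurableSpace.comap (R j) inferInstance) atTop ≤ mΩ :=
        limsup_le_of_le (by isBoundedDefault) (Eventually.of_forall fun j => (hR j).comap_le)
      exact hle _ htail
    exact (prob_compl_eq_zero_iff hEm).2 h

/-- A nondegenerate random walk oscillates, drifts to `∞` or drifts to `-∞`. -/
lemma blockSum_trichotomy [IsProbabilityMeasure Q] (hR : ∀ j, Measurable (R j))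
    (hind : iIndepFun R Q) (heven : ∀ n, Q.map (R (2 * n)) = Q.map (R 0))
    (hodd : ∀ n, Q.map (R (2 * n + 1)) = Q.map (R 1))
    (hne : ¬ ∀ᵐ ω ∂Q, g (R 0 ω) (R 1 ω) = 0) :
    (∀ᵐ ω ∂Q, (∀ C, ∃ᶠ n in atTop, C ≤ blockSum R g 0 n ω) ∧
        ∀ C, ∃ᶠ n in atTop, blockSum R g 0 n ω ≤ C) ∨
      (∀ᵐ ω ∂Q, Tendsto (fun n => blockSum R g 0 n ω) atTop atTop) ∨
      ∀ᵐ ω ∂Q, Tendsto (fun n => blockSum R g 0 n ω) atTop atBot := by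
  have hneg : ∀ n ω, blockSum R (fun a b => -g a b) 0 n ω = -blockSum R g 0 n ω := fun n ω => by
    simp [blockSum]
  rcases ae_frequently_le_or_ae_not hR hind g with h₁ | h₁
  · rcases ae_frequently_le_or_ae_not hR hind (fun a b => -g a b) with h₂ | h₂
    · left
      filter_upwards [h₁, h₂] with ω h₁ h₂
      refine ⟨h₁, fun C => (h₂ (-C)).mono fun n hn => ?_⟩
      rw [hneg] at hn
      omega
    · right; left
      have hne' : ¬ ∀ᵐ ω ∂Q, -g (R 0 ω) (R 1 ω) = 0 := by simpa using hne
      filter_upwards [h₂, ae_tendsto_atBot_of_not_frequently (g := fun a b => -g a b)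
        hR hind heven hodd hne'] with ω h₂ h
      simpa [hneg] using h h₂
  · right; right
    filter_upwards [h₁, ae_tendsto_atBot_of_not_frequently hR hind heven hodd hne] with ω h₁ h
    exact h h₁

/-- Independent variables that agree almost surely are almost surely constant. -/
lemma exists_ae_eq_const_of_indepFun [IsProbabilityMeasure Q] {Y Z : Ω → ℕ}
    (hind : IndepFun Y Z Q) (heq : ∀ᵐ ω ∂Q, Y ω = Z ω) :
    ∃ a, ∀ᵐ ω ∂Q, Y ω = a ∧ Z ω = a := by
  obtain ⟨a, ha⟩ : ∃ a, Q (Y ⁻¹' {a}) ≠ 0 := by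
    by_contra! h
    have : ∀ᵐ ω ∂Q, ∀ a, Y ω ≠ a := ae_all_iff.2 fun a => measure_eq_zero_iff_ae_notMem.1 (h a)
    obtain ⟨ω, hω⟩ := this.exists
    exact hω _ rfl
  have h0 : Q (Y ⁻¹' {a} ∩ Z ⁻¹' {a}ᶜ) = 0 := by
    refine measure_eq_zero_iff_ae_notMem.2 (heq.mono fun ω hω h => h.2 ?_)
    simpa [← hω] using h.1
  rw [hind.measure_inter_preimage_eq_mul _ _ (measurableSet_singleton a)
    (measurableSet_singleton a).compl, mul_eq_zero] at h0
  refine ⟨a, ?_⟩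
  filter_upwards [measure_eq_zero_iff_ae_notMem.1 (h0.resolve_left ha), heq] with ω h₁ h₂
  have : Z ω = a := by simpa using h₁
  exact ⟨h₂.trans this, this⟩

/-- If the valleys are infinitely often below `C`, then so are the peaks, up to a constant: the
rise out of a low valley is bounded with positive probability, independently of the past. -/
lemma ae_frequently_peak_le [IsProbabilityMeasure Q] (hR : ∀ j, Measurable (R j))
    (hind : iIndepFun R Q) (hodd : ∀ n, Q.map (R (2 * n + 1)) = Q.map (R 1)) :
    ∃ K : ℤ, ∀ᵐ ω ∂Q, ∀ C : ℤ,
      (∃ᶠ n in atTop, blockSum R (fun a b => (b : ℤ) - a) 0 n ω - R (2 * n) ω ≤ C) →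
        ∃ᶠ n in atTop, blockSum R (fun a b => (b : ℤ) - a) 0 n ω ≤ C + K := by
  obtain ⟨K, hK⟩ : ∃ K : ℕ, Q (R 1 ⁻¹' {K}) ≠ 0 := by
    by_contra! h
    have : ∀ᵐ ω ∂Q, ∀ a, R 1 ω ≠ a := ae_all_iff.2 fun a => measure_eq_zero_iff_ae_notMem.1 (h a)
    obtain ⟨ω, hω⟩ := this.exists
    exact hω _ rfl
  refine ⟨K, ae_all_iff.2 fun C => ?_⟩
  have key := ae_frequently_and (Q := Q)
    (A := fun n => {ω | blockSum R (fun a b => (b : ℤ) - a) 0 n ω - R (2 * n) ω ≤ C})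
    (B := fun n => R (2 * n + 1) ⁻¹' {K}) hR hind 1 (fun n => ?_) (fun n => ?_)
    (p := Q.real (R 1 ⁻¹' {K})) (ENNReal.toReal_pos hK (measure_ne_top _ _)) fun n => ?_
  · filter_upwards [key] with ω hω h
    refine (tendsto_add_atTop_nat 1).frequently ((hω h).mono ?_)
    rintro n ⟨h₁, h₂⟩
    have h₂ : R (2 * n + 1) ω = K := h₂
    have h₁ : blockSum R (fun a b => (b : ℤ) - a) 0 n ω - R (2 * n) ω ≤ C := h₁
    rw [blockSum_zero_succ, h₂]
    omega
  · have h₁ : Measurable[sigmaOf R (Set.Iio (2 * n + 1))]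
        (blockSum R (fun a b => (b : ℤ) - a) 0 n) :=
      measurable_blockSum 0 n fun j hj => lt_trans hj.2 (by simp)
    have h₂ : Measurable[sigmaOf R (Set.Iio (2 * n + 1))] fun ω => (R (2 * n) ω : ℤ) :=
      Measurable.of_discrete.comp (measurable_sigmaOf (by simp))
    exact (h₁.sub h₂) measurableSet_Iic
  · exact measurable_sigmaOf (s := Set.Ico (2 * n + 1) (2 * (n + 1) + 1))
      ⟨by omega, by omega⟩ (measurableSet_singleton K)
  · rw [← map_measureReal_apply (hR _) (measurableSet_singleton K), ← hodd n,
      map_measureReal_apply (hR _) (measurableSet_singleton K)]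

end RandomWalk

end PersistentWalk

/-! ### Independence of the run lengths -/

namespace PersistentWalk

section ProductLaw

variable {Ω : Type v} {mΩ : MeasurableSpace Ω} {Q : Measure Ω}

lemma measure_eq_of_measure_prefix_eq_prod [IsProbabilityMeasure Q] {R : ℕ → Ω → ℕ}
    (hR : ∀ j, Measurable (R j)) {p : ℕ → ℕ → ENNReal}
    (h : ∀ (n : ℕ) (a : ℕ → ℕ), Q {ω | ∀ i < n, R i ω = a i} = ∏ i ∈ Finset.range n, p i (a i))
    (n b : ℕ) :
    Q (R n ⁻¹' {b}) = p n b := by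
  let X : Ω → Fin n → ℕ := fun ω i => R i ω
  have hX : Measurable X := measurable_pi_iff.2 fun i => hR i
  have key : (Q.restrict (R n ⁻¹' {b})).map X = p n b • Q.map X := by
    refine Measure.ext_of_singleton fun a => ?_
    rw [Measure.smul_apply, Measure.map_apply hX (measurableSet_singleton a),
      Measure.map_apply hX (measurableSet_singleton a),
      Measure.restrict_apply (hX (measurableSet_singleton a)), smul_eq_mul]
    let a' : ℕ → ℕ := fun i => if hi : i < n then a ⟨i, hi⟩ else b
    have e₁ : X ⁻¹' {a} = {ω | ∀ i < n, R i ω = a' i} := by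
      ext ω
      simp only [X, a', Set.mem_preimage, Set.mem_singleton_iff, funext_iff, Fin.forall_iff,
        Set.mem_ofPred_eq]
      exact forall₂_congr fun i hi => by rw [dif_pos hi]
    have e₂ : X ⁻¹' {a} ∩ R n ⁻¹' {b} = {ω | ∀ i < n + 1, R i ω = a' i} := by
      rw [e₁]
      ext ω
      simp only [Set.mem_inter_iff, Set.mem_ofPred_eq, Nat.forall_lt_succ_right, Set.mem_preimage,
        Set.mem_singleton_iff]
      simp [a']
    rw [e₂, e₁, h, h, Finset.prod_range_succ, mul_comm]
    simp [a']
  have := congrArg (fun μ => μ Set.univ) key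
  simpa [Measure.map_apply hX MeasurableSet.univ, (hR n) (measurableSet_singleton b)] using this

/-- Variables whose finite-dimensional probabilities factorize are independent. -/
lemma iIndepFun_of_measure_prefix_eq_prod [IsProbabilityMeasure Q] {R : ℕ → Ω → ℕ}
    (hR : ∀ j, Measurable (R j)) {p : ℕ → ℕ → ENNReal}
    (h : ∀ (n : ℕ) (a : ℕ → ℕ), Q {ω | ∀ i < n, R i ω = a i} = ∏ i ∈ Finset.range n, p i (a i)) :
    iIndepFun R Q := by
  have hfin : ∀ n, iIndepFun (fun i : Fin n => R i) Q := by
    intro n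
    have hX : Measurable fun ω (i : Fin n) => R i ω := measurable_pi_iff.2 fun i => hR i
    rw [iIndepFun_iff_map_fun_eq_pi_map (f := fun i : Fin n => R i) fun i => (hR i).aemeasurable]
    refine Measure.ext_of_singleton fun a => ?_
    have := fun i : Fin n => Measure.isProbabilityMeasure_map (μ := Q) (hR i).aemeasurable
    rw [Measure.pi_singleton, Measure.map_apply hX (measurableSet_singleton a)]
    let a' : ℕ → ℕ := fun i => if hi : i < n then a ⟨i, hi⟩ else 0
    have e : (fun ω (i : Fin n) => R i ω) ⁻¹' {a} = {ω | ∀ i < n, R i ω = a' i} := by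
      ext ω
      simp only [a', Set.mem_preimage, Set.mem_singleton_iff, funext_iff, Fin.forall_iff,
        Set.mem_ofPred_eq]
      exact forall₂_congr fun i hi => by rw [dif_pos hi]
    rw [e, h, ← Fin.prod_univ_eq_prod_range (fun i => p i (a' i)) n]
    refine Finset.prod_congr rfl fun i _ => ?_
    rw [Measure.map_apply (hR i) (measurableSet_singleton _),
      measure_eq_of_measure_prefix_eq_prod hR h]
    simp [a']
  rw [iIndepFun_iff_finset]
  intro s
  obtain ⟨n, hn⟩ := s.exists_nat_subset_range
  have hlt : ∀ i : s, (i : ℕ) < n := fun i => Finset.mem_range.1 (hn i.2)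
  exact (hfin n).precomp (g := fun i : s => (⟨i, hlt i⟩ : Fin n)) fun i j hij =>
    Subtype.ext (congrArg Fin.val hij)

end ProductLaw

lemma StartPath.runLen_eq_iff {x : ℕ → Letter} (hx : StartPath x) (n : ℕ) {j : ℕ} (hj : 0 < j) :
    runLen x n = j ↔ (∀ i < j, x (breakTime x n + 1 + i) = n.bodd) ∧
      x (breakTime x n + j + 1) = !n.bodd := by
  have hs := hx.breakTime_succ n
  have hs' := hx.breakTime_succ (n + 1)
  have hp := hx.runLen_pos (n + 1)
  have hnext : x (breakTime x (n + 1) + 1) = !n.bodd := by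
    rw [hx.eq_bodd (n + 1) (by omega) (by omega), Nat.bodd_succ]
  constructor
  · rintro rfl
    refine ⟨fun i hi => hx.eq_bodd n (by omega) (by omega), ?_⟩
    rw [← hs, hnext]
  · rintro ⟨h₁, h₂⟩
    rcases lt_trichotomy (runLen x n) j with h | h | h
    · have := h₁ _ h
      rw [add_right_comm, ← hs, hnext] at this
      simp at this
    · exact h
    · rw [hx.eq_bodd n (by omega) (by omega)] at h₂
      simp at h₂

lemma runLength_eq {w : Word} {m : ℕ} (h : ∀ i < m, w i = w 0) (hm : w m ≠ w 0) :
    runLength w = m := by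
  refine le_antisymm (iInf₂_le m hm) (le_iInf₂ fun i hi => ?_)
  exact_mod_cast not_lt.1 fun hlt => hi (h i hlt)

lemma measurable_append (l : Letter) : Measurable fun w : Word => append w l := by
  refine measurable_pi_iff.2 fun i => ?_
  cases i with
  | zero => exact measurable_const
  | succ i => exact measurable_pi_apply i

lemma nextProb_add_nextProb (α : Letter → ℕ∞ → ℝ) (w : Word) :
    nextProb α w up + nextProb α w down = 1 := by
  unfold nextProb up down
  cases w 0 <;> simp

section Letters

variable {Ω : Type v} {U : ℕ → Ω → Word}

/-- The sigma-algebra generated by the letters `X_0, …, X_k`. -/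
@[reducible]
def pastLetters (U : ℕ → Ω → Word) (k : ℕ) : MeasurableSpace Ω :=
  MeasurableSpace.comap (fun ω i => letters U ω (min i k) : Ω → ℕ → Letter) inferInstance

lemma measurable_pastLetters {j k : ℕ} (h : j ≤ k) :
    Measurable[pastLetters U k] fun ω => letters U ω j := by
  have := (measurable_pi_apply (X := fun _ : ℕ => Letter) j).comp
    (comap_measurable (fun ω i => letters U ω (min i k) : Ω → ℕ → Letter))
  simpa only [Function.comp_def, min_eq_left h] using this

lemma pastLetters_mono {j k : ℕ} (h : j ≤ k) : pastLetters U j ≤ pastLetters U k := by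
  have : Measurable[pastLetters U k] (fun ω i => letters U ω (min i j) : Ω → ℕ → Letter) :=
    @measurable_pi_lambda _ _ _ (pastLetters U k) _ _ fun i =>
      measurable_pastLetters ((min_le_right i j).trans h)
  exact this.comap_le

/-- The event that the path starts with an up-down change and that its first `n` runs have the
lengths `a 0, …, a (n - 1)`, in terms of finitely many letters. -/
def runEvent (U : ℕ → Ω → Word) (a : ℕ → ℕ) : ℕ → Set Ω
  | 0 => startEvent U
  | n + 1 => runEvent U a n ∩
      {ω | (∀ i < a n, letters U ω (∑ i ∈ Finset.range n, a i + 1 + i) = n.bodd) ∧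
        letters U ω (∑ i ∈ Finset.range n, a i + a n + 1) = !n.bodd}

lemma measurableSet_runEvent (a : ℕ → ℕ) (n : ℕ) :
    MeasurableSet[pastLetters U (∑ i ∈ Finset.range n, a i + 1)] (runEvent U a n) := by
  induction n with
  | zero =>
    exact (measurable_pastLetters (by simp) (measurableSet_singleton up)).inter
      (measurable_pastLetters (by simp) (measurableSet_singleton down))
  | succ n ih =>
    rw [Finset.sum_range_succ]
    refine (pastLetters_mono (by omega) _ ih).inter ?_
    have : {ω | (∀ i < a n, letters U ω (∑ i ∈ Finset.range n, a i + 1 + i) = n.bodd) ∧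
        letters U ω (∑ i ∈ Finset.range n, a i + a n + 1) = !n.bodd} =
        (⋂ i, ⋂ (_ : i < a n),
          {ω | letters U ω (∑ i ∈ Finset.range n, a i + 1 + i) = n.bodd}) ∩
        {ω | letters U ω (∑ i ∈ Finset.range n, a i + a n + 1) = !n.bodd} := by ext; simp
    rw [this]
    exact (MeasurableSet.iInter fun i => MeasurableSet.iInter fun hi =>
      measurable_pastLetters (by omega) (measurableSet_singleton _)).inter
      (measurable_pastLetters le_rfl (measurableSet_singleton _))

lemma letters_of_mem_runEvent {a : ℕ → ℕ} (ha : ∀ i, 0 < a i) {n : ℕ} {ω : Ω}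
    (h : ω ∈ runEvent U a n) :
    letters U ω (∑ i ∈ Finset.range n, a i + 1) = n.bodd ∧
      letters U ω (∑ i ∈ Finset.range n, a i) = !n.bodd := by
  cases n with
  | zero => exact ⟨h.2, h.1⟩
  | succ n =>
    obtain ⟨-, h₁, h₂⟩ := h
    rw [Finset.sum_range_succ, Nat.bodd_succ, Bool.not_not]
    refine ⟨h₂, ?_⟩
    have := h₁ (a n - 1) (Nat.sub_lt (ha n) one_pos)
    rwa [show ∑ i ∈ Finset.range n, a i + 1 + (a n - 1) = ∑ i ∈ Finset.range n, a i + a n by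
      have := ha n; omega] at this

lemma mem_runEvent_iff {a : ℕ → ℕ} (ha : ∀ i, 0 < a i) {ω : Ω} (hx : StartPath (letters U ω))
    (n : ℕ) : ω ∈ runEvent U a n ↔ ∀ i < n, runLen (letters U ω) i = a i := by
  induction n with
  | zero =>
    have : ω ∈ runEvent U a 0 := ⟨hx.zero, hx.one⟩
    simpa using this
  | succ n ih =>
    rw [runEvent, Set.mem_inter_iff, ih, Nat.forall_lt_succ_right]
    refine and_congr_right fun h => ?_
    have hb : ∀ k ≤ n, breakTime (letters U ω) k = ∑ i ∈ Finset.range k, a i := by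
      intro k hk
      induction k with
      | zero => simp [hx.breakTime_zero]
      | succ k ihk =>
        rw [hx.breakTime_succ, ihk (by omega), h k (by omega), Finset.sum_range_succ]
    rw [hx.runLen_eq_iff n (ha n), hb n le_rfl]
    rfl

lemma runEvent_subset (a : ℕ → ℕ) (n : ℕ) : runEvent U a n ⊆ startEvent U := by
  induction n with
  | zero => exact subset_rfl
  | succ n ih => exact Set.inter_subset_left.trans ih

end Letters

section Chain

variable {Ω : Type v} {mΩ : MeasurableSpace Ω} {P : Measure Ω}
  {α : Letter → ℕ∞ → ℝ} {U : ℕ → Ω → Word}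

lemma IsVLMC.measurable_letters (hU : IsVLMC α P U) (n : ℕ) :
    Measurable fun ω => letters U ω n :=
  (measurable_pi_apply 0).comp (hU.measurable n)

lemma IsVLMC.measurableSet_append (hU : IsVLMC α P U) (n : ℕ) (l : Letter) :
    MeasurableSet {ω | U (n + 1) ω = append (U n ω) l} := by
  have : {ω | U (n + 1) ω = append (U n ω) l} = ⋂ i, {ω | U (n + 1) ω i = append (U n ω) l i} := by
    ext ω; simp [funext_iff]
  rw [this]
  refine MeasurableSet.iInter fun i => measurableSet_eq_fun ?_ ?_
  · exact (measurable_pi_apply i).comp (hU.measurable (n + 1))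
  · exact (measurable_pi_apply i).comp ((measurable_append l).comp (hU.measurable n))

lemma IsVLMC.measurableSet_startEvent (hU : IsVLMC α P U) : MeasurableSet (startEvent U) :=
  (hU.measurable_letters 0 (measurableSet_singleton up)).inter
    (hU.measurable_letters 1 (measurableSet_singleton down))

variable [IsProbabilityMeasure P]

/-- The transition probabilities to the two one-letter extensions add up to one, so almost surely
each word is an extension of the previous one. -/
lemma IsVLMC.ae_eq_append (hU : IsVLMC α P U) :
    ∀ᵐ ω ∂P, ∀ n, U (n + 1) ω = append (U n ω) (letters U ω (n + 1)) := by
  refine ae_all_iff.2 fun n => ?_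
  let E : Letter → Set Ω := fun l => {ω | U (n + 1) ω = append (U n ω) l}
  have hE : ∀ l, MeasurableSet (E l) := hU.measurableSet_append n
  have hint : ∀ l, ∫ ω, nextProb α (U n ω) l ∂P = P.real (E l) := fun l => by
    rw [← integral_congr_ae (hU.transition n l), integral_condExp (hU.measurable n).comap_le]
    exact integral_indicator_one (hE l)
  have hi : ∀ l, Integrable (fun ω => nextProb α (U n ω) l) P := fun l =>
    integrable_condExp.congr (hU.transition n l)
  have hsum : P.real (E up) + P.real (E down) = 1 := by
    rw [← hint, ← hint, ← integral_add (hi _) (hi _)]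
    simp [nextProb_add_nextProb]
  have hdisj : Disjoint (E up) (E down) := Set.disjoint_left.2 fun ω h₁ h₂ => by
    have := congrFun (h₁.symm.trans h₂) 0
    simp [append] at this
  rw [← measureReal_union hdisj (hE _)] at hsum
  have hu : P (E up ∪ E down)ᶜ = 0 := by
    rw [prob_compl_eq_zero_iff ((hE _).union (hE _))]
    rwa [measureReal_def, ENNReal.toReal_eq_one_iff] at hsum
  have hall : ∀ᵐ ω ∂P, ω ∈ E up ∪ E down := by
    filter_upwards [measure_eq_zero_iff_ae_notMem.1 hu] with ω hω
    exact not_not.1 hω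
  filter_upwards [hall] with ω hω
  have hl : ∀ l, U (n + 1) ω = append (U n ω) l →
      U (n + 1) ω = append (U n ω) (letters U ω (n + 1)) := fun l h => by
    have : letters U ω (n + 1) = l := congrFun h 0
    rw [this, h]
  exact hω.elim (hl _) (hl _)

/-- The word `U n` records the letters `X_n, X_{n-1}, …, X_0`. -/
lemma IsVLMC.ae_eq_letters (hU : IsVLMC α P U) :
    ∀ᵐ ω ∂P, ∀ n k, k ≤ n → U n ω k = letters U ω (n - k) := by
  filter_upwards [hU.ae_eq_append] with ω hω n
  induction n with
  | zero =>
    intro k hk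
    obtain rfl : k = 0 := by omega
    rfl
  | succ n ih =>
    rintro (_ | k) hk
    · rfl
    · rw [hω n, Nat.succ_sub_succ]
      exact ih k (by omega)

/-- Markov property in terms of letters: when the letters up to time `k` are known and end with a
run of `m` letters `l`, the next letter has the distribution attached to that run. The change
is visible among the letters `X_0, …, X_k`, so that the rest of the word `U_0` is irrelevant. -/
lemma IsVLMC.measure_inter_next (hU : IsVLMC α P U)
    (hα : ∀ (l : Letter) (n : ℕ∞), 1 ≤ n → α l n ∈ Set.Icc (0 : ℝ) 1) {k m : ℕ} (hm : 1 ≤ m)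
    (hmk : m ≤ k) (l l' : Letter) {A : Set Ω} (hA : MeasurableSet[pastLetters U k] A)
    (hrun : ∀ ω ∈ A, (∀ i < m, letters U ω (k - i) = l) ∧ letters U ω (k - m) = !l) :
    P (A ∩ {ω | letters U ω (k + 1) = l'}) =
      P A * ENNReal.ofReal (if l' = l then 1 - α l m else α l m) := by
  set q : ℝ := if l' = l then 1 - α l m else α l m with hq
  have hq0 : 0 ≤ q := by
    have := hα l m (by exact_mod_cast hm)
    rw [hq]; split_ifs
    · exact sub_nonneg.2 this.2
    · exact this.1
  obtain ⟨T, hT, rfl⟩ := hA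
  set φ : Ω → ℕ → Letter := fun ω i => letters U ω (min i k) with hφ
  let A' : Set Ω := U k ⁻¹' ((fun w i => w (k - min i k)) ⁻¹' T)
  have hcomap : MeasurableSet[MeasurableSpace.comap (U k) inferInstance] A' :=
    ⟨_, (measurable_pi_iff.2 fun i => measurable_pi_apply _ : Measurable
      fun (w : Word) (i : ℕ) => w (k - min i k)) hT, rfl⟩
  let E : Set Ω := {ω | U (k + 1) ω = append (U k ω) l'}
  have hE : MeasurableSet E := hU.measurableSet_append k l'
  have hAA' : (φ ⁻¹' T : Set Ω) =ᵐ[P] A' := by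
    filter_upwards [hU.ae_eq_letters] with ω hω
    have : φ ω = fun i => U k ω (k - min i k) := funext fun i => by
      rw [hω k _ (Nat.sub_le _ _), hφ]
      exact congrArg _ (by omega)
    exact congrArg (· ∈ T) this
  have hEX : ({ω | letters U ω (k + 1) = l'} : Set Ω) =ᵐ[P] E := by
    filter_upwards [hU.ae_eq_append] with ω hω
    refine propext ⟨fun h => ?_, fun h => congrFun h 0⟩
    have h : letters U ω (k + 1) = l' := h
    show U (k + 1) ω = append (U k ω) l'
    rw [← h]
    exact hω k
  have hreal : P.real (A' ∩ E) = P.real A' * q := by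
    have h₁ := setIntegral_condExp (hU.measurable k).comap_le
      ((integrable_const (1 : ℝ)).indicator (μ := P) hE) hcomap
    have h₂ : ∫ ω in A', E.indicator (fun _ => (1 : ℝ)) ω ∂P = P.real (A' ∩ E) := by
      rw [setIntegral_indicator hE]; simp
    have h₃ : ∫ ω in A', (P⟦E | MeasurableSpace.comap (U k) inferInstance⟧) ω ∂P =
        ∫ _ω in A', q ∂P := by
      refine setIntegral_congr_ae ((hU.measurable k).comap_le _ hcomap) ?_
      filter_upwards [hU.transition k l', hU.ae_eq_letters, hAA'] with ω h₁ h₂ h₃ hmem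
      rw [h₁]
      obtain ⟨h₄, h₅⟩ := hrun ω (h₃.mpr hmem)
      have hw0 : U k ω 0 = l := h₄ 0 hm
      have hlen : runLength (U k ω) = m := runLength_eq
        (fun i hi => by rw [hw0, h₂ k i (by omega), h₄ i hi])
        (by rw [hw0, h₂ k m hmk, h₅]; simp)
      rw [nextProb, hw0, hlen]
    rw [← h₂, ← h₁, h₃]
    simp
  rw [measure_congr (hAA'.inter hEX), measure_congr hAA']
  rw [← ENNReal.toReal_eq_toReal_iff' (measure_ne_top _ _)
    (ENNReal.mul_ne_top (measure_ne_top _ _) ENNReal.ofReal_ne_top), ENNReal.toReal_mul,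
    ENNReal.toReal_ofReal hq0]
  exact hreal

/-- Probability that a run of letters `l` has length `j`. -/
noncomputable def runProb (α : Letter → ℕ∞ → ℝ) (l : Letter) : ℕ → ENNReal
  | 0 => 0
  | j + 1 => (∏ i ∈ Finset.range j, ENNReal.ofReal (1 - α l ((i + 1 : ℕ) : ℕ∞))) *
      ENNReal.ofReal (α l ((j + 1 : ℕ) : ℕ∞))

/-- Given the letters up to time `N + 1`, where a run of letters `l` has just begun, this run has
length `j` with probability `runProb α l j`. -/
lemma IsVLMC.measure_inter_run (hU : IsVLMC α P U)
    (hα : ∀ (l : Letter) (n : ℕ∞), 1 ≤ n → α l n ∈ Set.Icc (0 : ℝ) 1) {N : ℕ} (l : Letter)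
    {A : Set Ω} (hA : MeasurableSet[pastLetters U (N + 1)] A)
    (hrun : ∀ ω ∈ A, letters U ω (N + 1) = l ∧ letters U ω N = !l) {j : ℕ} (hj : 0 < j) :
    P (A ∩ {ω | (∀ i < j, letters U ω (N + 1 + i) = l) ∧ letters U ω (N + j + 1) = !l}) =
      P A * runProb α l j := by
  obtain ⟨j, rfl⟩ : ∃ i, j = i + 1 := ⟨j - 1, by omega⟩
  -- the run lasts at least `j + 1` letters
  let S : ℕ → Set Ω := fun j => A ∩ {ω | ∀ i < j + 1, letters U ω (N + 1 + i) = l}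
  have hSm : ∀ j, MeasurableSet[pastLetters U (N + 1 + j)] (S j) := fun j => by
    refine MeasurableSet.inter (pastLetters_mono (by omega) _ hA) ?_
    have : {ω | ∀ i < j + 1, letters U ω (N + 1 + i) = l} =
        ⋂ i, ⋂ (_ : i < j + 1), {ω | letters U ω (N + 1 + i) = l} := by ext; simp
    rw [this]
    exact MeasurableSet.iInter fun i => MeasurableSet.iInter fun hi =>
      measurable_pastLetters (by omega) (measurableSet_singleton l)
  have hSrun : ∀ j, ∀ ω ∈ S j, (∀ i < j + 1, letters U ω (N + 1 + j - i) = l) ∧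
      letters U ω (N + 1 + j - (j + 1)) = !l := by
    rintro j ω ⟨h₁, h₂⟩
    refine ⟨fun i hi => ?_, ?_⟩
    · rw [Nat.add_sub_assoc (by omega)]
      exact h₂ _ (by omega)
    · rw [show N + 1 + j - (j + 1) = N by omega]
      exact (hrun ω h₁).2
  have hS : ∀ j, P (S j) = P A * ∏ i ∈ Finset.range j, ENNReal.ofReal (1 - α l ((i + 1 : ℕ))) := by
    intro j
    induction j with
    | zero =>
      have : S 0 = A := Set.inter_eq_left.2 fun ω hω i hi => by
        obtain rfl : i = 0 := by omega
        exact (hrun ω hω).1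
      simp [this]
    | succ j ih =>
      have e : S (j + 1) = S j ∩ {ω | letters U ω (N + 1 + j + 1) = l} := by
        ext ω
        simp only [S, Set.mem_inter_iff, Set.mem_ofPred_eq, and_assoc]
        rw [Nat.forall_lt_succ_right, ← add_assoc]
      rw [e, hU.measure_inter_next hα (by omega) (by omega) l l (hSm j) (hSrun j), ih,
        Finset.prod_range_succ, if_pos rfl, mul_assoc]
  have e : A ∩ {ω | (∀ i < j + 1, letters U ω (N + 1 + i) = l) ∧
      letters U ω (N + (j + 1) + 1) = !l} = S j ∩ {ω | letters U ω (N + 1 + j + 1) = !l} := by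
    ext ω
    simp only [S, Set.mem_inter_iff, Set.mem_ofPred_eq, and_assoc,
      show N + (j + 1) + 1 = N + 1 + j + 1 by omega]
  rw [e, hU.measure_inter_next hα (by omega) (by omega) l (!l) (hSm j) (hSrun j), hS,
    if_neg (by simp), mul_assoc, runProb]

lemma IsVLMC.measure_runEvent (hU : IsVLMC α P U)
    (hα : ∀ (l : Letter) (n : ℕ∞), 1 ≤ n → α l n ∈ Set.Icc (0 : ℝ) 1) {a : ℕ → ℕ}
    (ha : ∀ i, 0 < a i) (n : ℕ) :
    P (runEvent U a n) = P (startEvent U) * ∏ i ∈ Finset.range n, runProb α i.bodd (a i) := by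
  induction n with
  | zero => simp [runEvent]
  | succ n ih =>
    rw [runEvent, hU.measure_inter_run hα _ (measurableSet_runEvent a n)
      (fun ω hω => letters_of_mem_runEvent ha hω) (ha n), ih, Finset.prod_range_succ, mul_assoc]

lemma measurable_sInf_nat {s : ℕ → Set Ω} (hs : ∀ k, MeasurableSet (s k)) :
    Measurable fun ω => sInf {k : ℕ | ω ∈ s k} := by
  refine measurable_to_countable' fun m => ?_
  have e : (fun ω => sInf {k : ℕ | ω ∈ s k}) ⁻¹' {m} =
      (s m ∩ ⋂ k, ⋂ (_ : k < m), (s k)ᶜ) ∪ {ω | m = 0 ∧ ω ∈ ⋂ k, (s k)ᶜ} := by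
    ext ω
    simp only [Set.mem_preimage, Set.mem_singleton_iff, Set.mem_union, Set.mem_inter_iff,
      Set.mem_iInter, Set.mem_compl_iff, Set.mem_ofPred_eq]
    constructor
    · rintro rfl
      rcases Set.eq_empty_or_nonempty {k : ℕ | ω ∈ s k} with h | h
      · exact Or.inr ⟨by rw [h, Nat.sInf_empty], fun k hk => (h ▸ hk : k ∈ (∅ : Set ℕ))⟩
      · exact Or.inl ⟨Nat.sInf_mem h, fun k hk => Nat.notMem_of_lt_sInf hk⟩
    · rintro (⟨h₁, h₂⟩ | ⟨rfl, h⟩)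
      · exact le_antisymm (Nat.sInf_le h₁) (le_csInf ⟨m, h₁⟩ fun k hk => not_lt.1 fun h => h₂ k h hk)
      · have : {k : ℕ | ω ∈ s k} = ∅ := Set.eq_empty_of_forall_notMem h
        rw [this, Nat.sInf_empty]
  rw [e]
  refine ((hs m).inter (MeasurableSet.iInter fun k => MeasurableSet.iInter fun _ =>
    (hs k).compl)).union ?_
  exact (MeasurableSet.const _).inter (MeasurableSet.iInter fun k => (hs k).compl)

lemma measurable_breakTime {X : Ω → ℕ → Letter} (hX : ∀ k, Measurable fun ω => X ω k) (n : ℕ) :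
    Measurable fun ω => breakTime (X ω) n := by
  have hne : ∀ k, MeasurableSet {ω | X ω k ≠ X ω (k + 1)} := fun k =>
    (measurableSet_eq_fun (hX k) (hX (k + 1))).compl
  induction n with
  | zero => exact measurable_sInf_nat hne
  | succ n ih =>
    exact measurable_sInf_nat fun k => (measurableSet_lt ih measurable_const).inter (hne k)

lemma measurable_runLen {X : Ω → ℕ → Letter} (hX : ∀ k, Measurable fun ω => X ω k) (n : ℕ) :
    Measurable fun ω => runLen (X ω) n :=
  (measurable_breakTime hX (n + 1)).sub (measurable_breakTime hX n)

lemma IsVLMC.ae_startPath (hU : IsVLMC α P U) (hadm : Admissible.{v} α) :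
    ∀ᵐ ω ∂cond P (startEvent U), StartPath (letters U ω) := by
  filter_upwards [ae_cond_mem hU.measurableSet_startEvent,
    cond_absolutelyContinuous.ae_le (hadm Ω P U hU)] with ω h₁ h₂
  exact ⟨h₁.1, h₁.2, h₂.mono fun n hn => by simp [hn.1, hn.2]⟩

/-- Under the conditional probability, the lengths of the first `n` runs have a product law. -/
lemma IsVLMC.cond_runLen_eq (hU : IsVLMC α P U) (hadm : Admissible.{v} α)
    (hα : ∀ (l : Letter) (n : ℕ∞), 1 ≤ n → α l n ∈ Set.Icc (0 : ℝ) 1)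
    (hstart : P (startEvent U) ≠ 0) (n : ℕ) (a : ℕ → ℕ) :
    cond P (startEvent U) {ω | ∀ i < n, runLen (letters U ω) i = a i} =
      ∏ i ∈ Finset.range n, runProb α i.bodd (a i) := by
  by_cases ha : ∀ i < n, 0 < a i
  · -- values of `a` from `n` on do not matter
    let a' : ℕ → ℕ := fun i => if i < n then a i else 1
    have ha' : ∀ i, 0 < a' i := fun i => by
      simp only [a']; split_ifs with h
      · exact ha i h
      · exact one_pos
    have e : ∀ i < n, a' i = a i := fun i hi => if_pos hi
    have hset : ({ω | ∀ i < n, runLen (letters U ω) i = a i} : Set Ω)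
        =ᵐ[cond P (startEvent U)] runEvent U a' n := by
      filter_upwards [hU.ae_startPath hadm] with ω hx
      refine propext (Iff.trans ?_ (mem_runEvent_iff ha' hx n).symm)
      exact forall₂_congr fun i hi => by rw [e i hi]
    rw [measure_congr hset, cond_apply hU.measurableSet_startEvent, 
      Set.inter_eq_right.2 (runEvent_subset a' n),
      hU.measure_runEvent hα ha', ← mul_assoc, ENNReal.inv_mul_cancel hstart (measure_ne_top _ _),
      one_mul]
    exact Finset.prod_congr rfl fun i hi => by rw [e i (Finset.mem_range.1 hi)]
  · push Not at ha
    obtain ⟨i, hi, h0⟩ := ha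
    have h0 : a i = 0 := by omega
    rw [Finset.prod_eq_zero (Finset.mem_range.2 hi) (by rw [h0]; rfl)]
    refine measure_eq_zero_iff_ae_notMem.2 ?_
    filter_upwards [hU.ae_startPath hadm] with ω hx h
    have := hx.runLen_pos i
    rw [h i hi, h0] at this
    exact lt_irrefl _ this

end Chain

end PersistentWalk

/-! ### Long time behaviour of the persistent walk -/

/-- `S` (the walk) and `M` (its skeleton) under `P` conditioned on `(X_0, X_1) = (u, d)`. -/
theorem lemma3p1 (α : Letter → ℕ∞ → ℝ)
    (hα : ∀ (l : Letter) (n : ℕ∞), 1 ≤ n → α l n ∈ Set.Icc (0 : ℝ) 1)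
    (hadm : Admissible.{v} α)
    {Ω : Type v} [MeasurableSpace Ω] (P : Measure Ω) [IsProbabilityMeasure P]
    (U : ℕ → Ω → Word) (hU : IsVLMC α P U) (hstart : P (startEvent U) ≠ 0) :
    (Recurrent (cond P (startEvent U)) (fun ω => walk (letters U ω)) ↔
      Oscillating (cond P (startEvent U)) (fun ω => skeleton (letters U ω))) ∧
    (TendsToTop (cond P (startEvent U)) (fun ω => walk (letters U ω)) ↔
      TendsToTop (cond P (startEvent U)) (fun ω => skeleton (letters U ω))) ∧
    (TendsToBot (cond P (startEvent U)) (fun ω => walk (letters U ω)) ↔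
      TendsToBot (cond P (startEvent U)) (fun ω => skeleton (letters U ω))) ∧
    (¬ ConstantRuns (cond P (startEvent U)) (letters U) →
      Recurrent (cond P (startEvent U)) (fun ω => walk (letters U ω)) ∨
      TendsToTop (cond P (startEvent U)) (fun ω => walk (letters U ω)) ∨
      TendsToBot (cond P (startEvent U)) (fun ω => walk (letters U ω))) := by
  have hQ : IsProbabilityMeasure (cond P (startEvent U)) := cond_isProbabilityMeasure hstart
  have hgood := hU.ae_startPath hadm
  have hlaw := hU.cond_runLen_eq hadm hα hstart
  set Q := cond P (startEvent U)
  let R : ℕ → Ω → ℕ := fun n ω => runLen (letters U ω) n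
  have hR : ∀ j, Measurable (R j) := measurable_runLen hU.measurable_letters
  have hind : iIndepFun R Q := iIndepFun_of_measure_prefix_eq_prod hR hlaw
  have hmap : ∀ i j, i.bodd = j.bodd → Q.map (R i) = Q.map (R j) := fun i j hij =>
    Measure.ext_of_singleton fun b => by
      rw [Measure.map_apply (hR i) (measurableSet_singleton b),
        Measure.map_apply (hR j) (measurableSet_singleton b),
        measure_eq_of_measure_prefix_eq_prod hR hlaw,
        measure_eq_of_measure_prefix_eq_prod hR hlaw, hij]
  have heven : ∀ n, Q.map (R (2 * n)) = Q.map (R 0) := fun n => hmap _ _ (by simp)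
  have hodd : ∀ n, Q.map (R (2 * n + 1)) = Q.map (R 1) := fun n => hmap _ _ (by simp)
  have hskel : ∀ᵐ ω ∂Q, ∀ n,
      skeleton (letters U ω) n = blockSum R (fun a b => (b : ℤ) - a) 0 n ω :=
    hgood.mono fun ω hx n => by rw [hx.skeleton_eq_sum, blockSum, Finset.range_eq_Ico]
  -- low valleys force low peaks
  obtain ⟨K, hK⟩ : ∃ K : ℤ, ∀ᵐ ω ∂Q, ∀ C : ℤ,
      (∃ᶠ n in atTop, skeleton (letters U ω) n - runLen (letters U ω) (2 * n) ≤ C) →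
        ∃ᶠ n in atTop, skeleton (letters U ω) n ≤ C + K := by
    obtain ⟨K, hK⟩ := ae_frequently_peak_le hR hind hodd
    refine ⟨K, ?_⟩
    filter_upwards [hK, hskel] with ω h₁ h₂
    simp only [h₂]
    exact h₁
  have hosc : Recurrent Q (fun ω => walk (letters U ω)) ↔
      Oscillating Q (fun ω => skeleton (letters U ω)) := by
    constructor
    · intro h
      filter_upwards [ae_all_iff.2 h, hgood, hK] with ω hω hx hKω
      refine ⟨(limsup_eq_top_iff _).2 fun C => hx.frequently_le_skeleton C (hω C),
        (liminf_eq_bot_iff _).2 fun C => ?_⟩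
      simpa using hKω (C - K) (hx.frequently_valley_le _ (hω _))
    · intro h z
      filter_upwards [h, hgood] with ω hω hx
      exact hx.frequently_walk_eq ((limsup_eq_top_iff _).1 hω.1) ((liminf_eq_bot_iff _).1 hω.2) z
  have htop : TendsToTop Q (fun ω => walk (letters U ω)) ↔
      TendsToTop Q (fun ω => skeleton (letters U ω)) := by
    constructor
    · intro h
      filter_upwards [h, hgood] with ω hω hx using hx.tendsto_skeleton hω
    · intro h
      filter_upwards [h, hgood, hK] with ω hω hx hKω
      refine hx.tendsto_walk_atTop (tendsto_atTop.2 fun C => ?_)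
      by_contra hC
      have hpeak := hKω C ((not_eventually.1 hC).mono fun n hn => by omega)
      obtain ⟨n, hn, hn'⟩ := (hpeak.and_eventually (tendsto_atTop.1 hω (C + K + 1))).exists
      omega
  have hbot : TendsToBot Q (fun ω => walk (letters U ω)) ↔
      TendsToBot Q (fun ω => skeleton (letters U ω)) := by
    constructor
    · intro h
      filter_upwards [h, hgood] with ω hω hx using hx.tendsto_skeleton hω
    · intro h
      filter_upwards [h, hgood] with ω hω hx using hx.tendsto_walk_atBot hω
  refine ⟨hosc, htop, hbot, fun hconst => ?_⟩
  have hne : ¬ ∀ᵐ ω ∂Q, (R 1 ω : ℤ) - R 0 ω = 0 := by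
    intro h0
    obtain ⟨a, ha⟩ := exists_ae_eq_const_of_indepFun (hind.indepFun zero_ne_one)
      (h0.mono fun ω hω => by omega)
    have hall : ∀ i j, Q.map (R i) = Q.map (R j) → (∀ᵐ ω ∂Q, R j ω = a) → ∀ᵐ ω ∂Q, R i ω = a := by
      intro i j hij h
      have h' : ∀ᵐ k ∂Q.map (R j), k = a := (ae_map_iff (hR j).aemeasurable
        (measurableSet_singleton a)).2 h
      rw [← hij] at h'
      exact ae_of_ae_map (hR i).aemeasurable h'
    refine hconst ⟨a, a, ?_⟩
    filter_upwards [ae_all_iff.2 fun n => hall _ _ (heven n) (ha.mono fun _ h => h.1),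
      ae_all_iff.2 fun n => hall _ _ (hodd n) (ha.mono fun _ h => h.2)] with ω h₁ h₂ n hn
    obtain ⟨n, rfl⟩ : ∃ k, n = k + 1 := ⟨n - 1, by omega⟩
    rw [tauDown_succ, tauUp_succ]
    exact ⟨h₁ n, h₂ n⟩
  rw [hosc, htop, hbot]
  rcases blockSum_trichotomy (g := fun a b => (b : ℤ) - a) hR hind heven hodd hne with h | h | h
  · left
    filter_upwards [h, hskel] with ω h₁ h₂
    simp only [limsup_eq_top_iff, liminf_eq_bot_iff, h₂]
    exact h₁
  · right; left
    filter_upwards [h, hskel] with ω h₁ h₂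
    rwa [show skeleton (letters U ω) = _ from funext h₂]
  · right; right
    filter_upwards [h, hskel] with ω h₁ h₂
    rwa [show skeleton (letters U ω) = _ from funext h₂]
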